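/- **Proposition 3.1.** Let $p$ be an odd prime, $n\ge 0$ an integer, and let $K=\mathbb{Q}(\mu_{p^{n+1}})$ be the $p^{n+1}$-th cyclotomic field. Let $S$ be the set of infinite places of $K$ and $T$ the (finite) set of places of $K$ above $2$. The Euler product $$\zeta_S(s)=\prod_{\mathfrak p\notin S}\frac{1}{1-N\mathfrak p^{-s}}$$ converges for $\mathrm{Re}(s)>1$ and has a meromorphic continuation to $\mathbb{C}$, again denoted $\zeta_S$. Let $$\zeta_{S,2}(s)=\prod_{\mathfrak p\in T}\bigl(1-N\mathfrak p^{\,1-s}\bigr)\cdot\zeta_S(s)$$ be the $(S,\{2\})$-refined Dedekind zeta function of $K$, regarded as a meromorphic function on $\mathbb{C}$ with removable singularities removed. Identify $\mathrm{Gal}(K/\mathbb{Q})$ with $(\mathbb{Z}/p^{n+1})^\times$, the class of $a$ acting on $\mu_{p^{n+1}}$ by $\zeta\mapsto\zeta^a$, and let $\chi$ run over the primitive Dirichlet characters induced by the complex characters of $\mathrm{Gal}(K/\mathbb{Q})$. For each such $\chi$ the series $$L_E(s,\chi)=2\sum_{m=1}^{\infty}\frac{(-1)^m\chi(m)}{m^s}$$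 converges for $\mathrm{Re}(s)>0$ and extends to an entire function, again denoted $L_E(s,\chi)$. Then, for all $s\in\mathbb{C}$, $$\zeta_{S,2}(s)=\prod_{\chi}\frac12\,L_E(s,\chi).$$ -/

import Mathlib

open NumberField IsDedekindDomain

noncomputable section

namespace RefinedZeta

section Zeta

variable (K : Type*) [Field K] [NumberField K]

/-- The places of a number field: the infinite ones and the finite ones (maximal ideals of the
ring of integers). -/
abbrev Place : Type _ := InfinitePlace K ⊕ HeightOneSpectrum (𝓞 K)

/-- The set of infinite (archimedean) places. -/
def infinitePlaces : Set (Place K) := Set.range Sum.inl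

variable {K}

/-- The norm `N𝔭` of a finite place, as a complex number. -/
def placeNorm (v : HeightOneSpectrum (𝓞 K)) : ℂ := (Ideal.absNorm v.asIdeal : ℂ)

/-- The local factor `(1 - N𝔭 ^ (-s))⁻¹`. -/
def localFactor (s : ℂ) (v : HeightOneSpectrum (𝓞 K)) : ℂ := (1 - placeNorm v ^ (-s))⁻¹

/-- The Euler product `∏_{𝔭 ∉ S} (1 - N𝔭 ^ (-s))⁻¹` over the places outside `S`, where `S` is a
set of places containing all infinite places; it is meant for `1 < re s`. -/
def eulerProduct (S : Set (Place K)) (s : ℂ) : ℂ :=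
  ∏' v : {v : HeightOneSpectrum (𝓞 K) // Sum.inr v ∉ S}, localFactor s v.1

/-- `F` is a meromorphic continuation of `f` from `U` to the whole plane. The values of `F` are
pinned down everywhere by asking for the normal form: `F` takes the value of its analytic extension
wherever there is one, and the value `0` at its poles. -/
structure IsMeromorphicContinuation (f : ℂ → ℂ) (U : Set ℂ) (F : ℂ → ℂ) : Prop where
  meromorphicNFOn : MeromorphicNFOn F Set.univ
  eqOn : Set.EqOn F f U

open Classical in
/-- The meromorphic continuation of `f` from `U` to the whole plane (if there is none, `0`).
It is unique when `U` is open and non-empty. -/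
def meromorphicContinuation (f : ℂ → ℂ) (U : Set ℂ) : ℂ → ℂ :=
  if h : ∃ F, IsMeromorphicContinuation f U F then h.choose else 0

/-- The zeta function `ζ_S` of the ring of `S`-integers: the meromorphic continuation to `ℂ` of the
Euler product over the places outside `S`. -/
def zetaS (S : Set (Place K)) : ℂ → ℂ :=
  meromorphicContinuation (eulerProduct S) {s | 1 < s.re}

/-- The `(S, T)`-refined zeta function `∏_{𝔭 ∈ T} (1 - N𝔭 ^ (1 - s)) * ζ_S(s)`, as a meromorphic
function on `ℂ`; removable singularities are removed. Here `T` is a finite set of finite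
places. -/
def refinedZeta (S : Set (Place K)) (T : Finset (HeightOneSpectrum (𝓞 K))) : ℂ → ℂ :=
  toMeromorphicNFOn (fun s => (∏ v ∈ T, (1 - placeNorm v ^ (1 - s))) * zetaS S s) Set.univ

variable (K)

theorem finite_placesAboveTwo :
    {v : HeightOneSpectrum (𝓞 K) | (2 : 𝓞 K) ∈ v.asIdeal}.Finite := by
  have h := Ideal.finite_factors (I := Ideal.span {(2 : 𝓞 K)}) (by simp)
  refine h.subset fun v hv => ?_
  simpa [Ideal.dvd_span_singleton] using hv

/-- The finite set of places above `2`. -/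
def placesAboveTwo : Finset (HeightOneSpectrum (𝓞 K)) := (finite_placesAboveTwo K).toFinset

end Zeta

section EulerL

variable {N : ℕ}

/-- `F` is the Euler `L`-function of `χ`: it is entire, and on `0 < re s` it is the sum of the
(in general only conditionally) convergent series `2 * ∑_{n ≥ 1} (-1) ^ n * χ(n) / n ^ s`. -/
structure IsEulerLFunction (χ : DirichletCharacter ℂ N) (F : ℂ → ℂ) : Prop where
  differentiable : Differentiable ℂ F
  tendsto : ∀ s : ℂ, 0 < s.re → Filter.Tendsto
    (fun M : ℕ => 2 * ∑ n ∈ Finset.Icc 1 M, (-1 : ℂ) ^ n * χ (n : ZMod N) / (n : ℂ) ^ s)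
    Filter.atTop (nhds (F s))

open Classical in
/-- The Euler `L`-function `L_E(s, χ)` on the whole plane (`0` if the series or its continuation
does not exist). -/
def eulerL (χ : DirichletCharacter ℂ N) : ℂ → ℂ :=
  if h : ∃ F, IsEulerLFunction χ F then h.choose else 0

end EulerL

/-- The Dirichlet character modulo `m` that corresponds to a character of the Galois group of the
`m`-th cyclotomic field under `(ℤ/m)ˣ ≃ Gal(K/ℚ)`, where `a` acts on `m`-th roots of unity by
`ζ ↦ ζ ^ a`. -/
def toDirichlet (m : ℕ) [NeZero m] (K : Type*) [Field K] [NumberField K]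
    [IsCyclotomicExtension {m} ℚ K] (ψ : Gal(K/ℚ) →* ℂˣ) : DirichletCharacter ℂ m :=
  MulChar.ofUnitHom (ψ.comp (IsCyclotomicExtension.Rat.galEquivZMod m K).symm.toMonoidHom)

/-- The primitive Dirichlet character induced by a character of the Galois group of the `m`-th
cyclotomic field; its modulus is its conductor. -/
def inducedPrimitive (m : ℕ) [NeZero m] (K : Type*) [Field K] [NumberField K]
    [IsCyclotomicExtension {m} ℚ K] (ψ : Gal(K/ℚ) →* ℂˣ) :
    DirichletCharacter ℂ (toDirichlet m K ψ).conductor :=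
  (toDirichlet m K ψ).primitiveCharacter

end RefinedZeta

end

section PeriodicDirichletSeries

open Filter Topology Complex

/-- Summation by parts. -/
theorem sum_range_mul_eq_add_sum_partialSums {R : Type*} [CommRing R] (a f : ℕ → R) (M : ℕ) :
    ∑ k ∈ Finset.range M, a k * f k = (∑ i ∈ Finset.range M, a i) * f M +
      ∑ k ∈ Finset.range M, (∑ i ∈ Finset.range (k + 1), a i) * (f k - f (k + 1)) := by
  induction M with
  | zero => simp
  | succ M ih =>
    rw [Finset.sum_range_succ, ih, Finset.sum_range_succ (n := M) (f := fun k => _ * (f k - _)),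
      Finset.sum_range_succ a M]
    ring

theorem sum_Icc_one_eq_sum_range {R : Type*} [AddCommMonoid R] (f : ℕ → R) (M : ℕ) :
    ∑ n ∈ Finset.Icc 1 M, f n = ∑ k ∈ Finset.range M, f (k + 1) := by
  induction M with
  | zero => simp
  | succ M ih => rw [Finset.sum_Icc_succ_top (by omega), Finset.sum_range_succ, ih]

theorem sum_range_natCast_add_eq_sum_univ {N : ℕ} [NeZero N] (Φ : ZMod N → ℂ) (c : ZMod N) :
    ∑ k ∈ Finset.range N, Φ (c + (k : ZMod N)) = ∑ j, Φ j := by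
  rw [← Equiv.sum_comp (Equiv.addLeft c) Φ]
  refine Finset.sum_bij' (fun k _ => (k : ZMod N)) (fun j _ => j.val) ?_ ?_ ?_ ?_ ?_
  · simp
  · intro j _
    simpa using ZMod.val_lt j
  · intro k hk
    exact ZMod.val_cast_of_lt (by simpa using hk)
  · intro j _
    simp
  · intro k _
    simp

theorem exists_norm_sum_range_le_of_sum_eq_zero {N : ℕ} [NeZero N] {Φ : ZMod N → ℂ}
    (hΦ : ∑ j, Φ j = 0) :
    ∃ C, ∀ M : ℕ, ‖∑ k ∈ Finset.range M, Φ ((k : ZMod N) + 1)‖ ≤ C := by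
  set A : ℕ → ℂ := fun M => ∑ k ∈ Finset.range M, Φ ((k : ZMod N) + 1) with hA
  have hper : Function.Periodic A N := by
    intro M
    simp only [hA, Finset.sum_range_add, add_eq_left]
    rw [← hΦ, ← sum_range_natCast_add_eq_sum_univ Φ ((M : ZMod N) + 1)]
    refine Finset.sum_congr rfl fun k _ => ?_
    push_cast
    congr 1
    ring
  refine ⟨∑ k ∈ Finset.range N, ‖A k‖, fun M => ?_⟩
  change ‖A M‖ ≤ _
  rw [← hper.map_mod_nat M]
  exact Finset.single_le_sum (f := fun k => ‖A k‖) (fun _ _ => norm_nonneg _)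
    (Finset.mem_range.mpr (Nat.mod_lt _ (NeZero.pos N)))

theorem norm_natCast_cpow_neg_sub_le {s : ℂ} (hs : 0 < s.re) (k : ℕ) :
    ‖((k + 1 : ℕ) : ℂ) ^ (-s) - ((k + 1 + 1 : ℕ) : ℂ) ^ (-s)‖ ≤
      ‖s‖ * ((k + 1 : ℕ) : ℝ) ^ (-s.re - 1) := by
  have hs0 : -s ≠ 0 := by
    intro h
    simp [neg_eq_zero.mp h] at hs
  have key := (convex_Icc ((k + 1 : ℕ) : ℝ) ((k + 1 + 1 : ℕ) : ℝ)).norm_image_sub_le_of_norm_hasDerivWithin_le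
    (f := fun t : ℝ => (t : ℂ) ^ (-s)) (f' := fun t : ℝ => -s * (t : ℂ) ^ (-s - 1))
    (C := ‖s‖ * ((k + 1 : ℕ) : ℝ) ^ (-s.re - 1))
    (x := ((k + 1 + 1 : ℕ) : ℝ)) (y := ((k + 1 : ℕ) : ℝ)) ?_ ?_
    (by constructor <;> push_cast <;> linarith) (by constructor <;> push_cast <;> linarith)
  · refine key.trans (le_of_eq ?_)
    push_cast
    norm_num
  · intro t ht
    have ht0 : (0 : ℝ) < t := lt_of_lt_of_le (by positivity) ht.1
    exact (hasDerivAt_ofReal_cpow_const ht0.ne' hs0).hasDerivWithinAt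
  · intro t ht
    have ht0 : (0 : ℝ) < t := lt_of_lt_of_le (by positivity) ht.1
    rw [norm_mul, norm_neg, norm_cpow_eq_rpow_re_of_pos ht0]
    gcongr ?_ * ?_
    simp only [sub_re, neg_re, one_re]
    exact Real.rpow_le_rpow_of_nonpos (by positivity) ht.1 (by linarith)

theorem tendsto_partialSums_of_sum_eq_zero {N : ℕ} [NeZero N] {Φ : ZMod N → ℂ}
    (hΦ : ∑ j, Φ j = 0) {s : ℂ} (hs : 0 < s.re) :
    Tendsto (fun M : ℕ => ∑ n ∈ Finset.Icc 1 M, Φ (n : ZMod N) / (n : ℂ) ^ s) atTop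
      (𝓝 (ZMod.LFunction Φ s)) := by
  obtain ⟨C, hC⟩ := exists_norm_sum_range_le_of_sum_eq_zero hΦ
  have hC0 : 0 ≤ C := (norm_nonneg _).trans (hC 0)
  set A : ℕ → ℂ := fun M => ∑ k ∈ Finset.range M, Φ ((k : ZMod N) + 1) with hA
  set G : ℕ → ℂ → ℂ := fun k z =>
    A (k + 1) * (((k + 1 : ℕ) : ℂ) ^ (-z) - ((k + 1 + 1 : ℕ) : ℂ) ^ (-z)) with hG
  have hpart (z : ℂ) (M : ℕ) : ∑ n ∈ Finset.Icc 1 M, Φ (n : ZMod N) / (n : ℂ) ^ z =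
      A M * ((M + 1 : ℕ) : ℂ) ^ (-z) + ∑ k ∈ Finset.range M, G k z := by
    have h := sum_range_mul_eq_add_sum_partialSums (fun k : ℕ => Φ ((k : ZMod N) + 1))
      (fun k => ((k + 1 : ℕ) : ℂ) ^ (-z)) M
    rw [← h, sum_Icc_one_eq_sum_range]
    refine Finset.sum_congr rfl fun k _ => ?_
    rw [cpow_neg, div_eq_mul_inv]
    push_cast
    rfl
  have hbound {z : ℂ} (hz : 0 < z.re) (k : ℕ) :
      ‖G k z‖ ≤ C * (‖z‖ * ((k + 1 : ℕ) : ℝ) ^ (-z.re - 1)) := by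
    rw [norm_mul]
    exact mul_le_mul (hC _) (norm_natCast_cpow_neg_sub_le hz k) (norm_nonneg _) hC0
  have hsumm {ε : ℝ} (hε : 0 < ε) : Summable fun k : ℕ => ((k + 1 : ℕ) : ℝ) ^ (-ε - 1) :=
    (summable_nat_add_iff 1).mpr (Real.summable_nat_rpow.mpr (by linarith))
  have hGsum {z : ℂ} (hz : 0 < z.re) : Summable fun k => G k z :=
    Summable.of_norm_bounded (((hsumm hz).mul_left _).mul_left _) (hbound hz)
  have htend {z : ℂ} (hz : 0 < z.re) :
      Tendsto (fun M : ℕ => ∑ n ∈ Finset.Icc 1 M, Φ (n : ZMod N) / (n : ℂ) ^ z) atTop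
        (𝓝 (∑' k, G k z)) := by
    simp only [hpart]
    rw [← zero_add (∑' k, G k z)]
    refine Tendsto.add ?_ (hGsum hz).hasSum.tendsto_sum_nat
    refine squeeze_zero_norm (a := fun M : ℕ => C * ((M + 1 : ℕ) : ℝ) ^ (-z.re)) (fun M => ?_) ?_
    · rw [norm_mul, norm_natCast_cpow_of_pos M.succ_pos, neg_re]
      gcongr
      exact hC M
    · rw [← mul_zero C]
      refine Tendsto.const_mul _ ((tendsto_rpow_neg_atTop hz).comp ?_)
      exact tendsto_natCast_atTop_atTop.comp (tendsto_add_atTop_nat 1)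
  have hdiff : DifferentiableOn ℂ (fun z => ∑' k, G k z) {z | 0 < z.re} := by
    intro w hw
    have hw : 0 < w.re := hw
    set U : Set ℂ := {z | w.re / 2 < z.re} ∩ Metric.ball 0 (‖w‖ + 1) with hU
    have hUo : IsOpen U := (isOpen_lt continuous_const continuous_re).inter Metric.isOpen_ball
    have hwU : w ∈ U := ⟨by simp only [Set.mem_ofPred_eq]; linarith, by simp⟩
    have := differentiableOn_tsum_of_summable_norm
      (((hsumm (half_pos hw)).mul_left (‖w‖ + 1)).mul_left C) (F := G) (U := U) ?_ hUo ?_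
    · exact (this.differentiableAt (hUo.mem_nhds hwU)).differentiableWithinAt
    · intro k z _
      refine DifferentiableAt.differentiableWithinAt ?_
      have h1 : ((k + 1 : ℕ) : ℂ) ≠ 0 := by exact_mod_cast k.succ_ne_zero
      have h2 : ((k + 1 + 1 : ℕ) : ℂ) ≠ 0 := by exact_mod_cast (k + 1).succ_ne_zero
      exact ((differentiableAt_id.neg.const_cpow (.inl h1)).sub
        (differentiableAt_id.neg.const_cpow (.inl h2))).const_mul _
    · intro k z hz
      have hz1 : w.re / 2 < z.re := hz.1
      have hz2 : ‖z‖ < ‖w‖ + 1 := by simpa using hz.2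
      refine (hbound (by linarith) k).trans ?_
      gcongr
      simp
  have heq : Set.EqOn (fun z => ∑' k, G k z) (ZMod.LFunction Φ) {z | 0 < z.re} := by
    have hopen : IsOpen {z : ℂ | 0 < z.re} := isOpen_lt continuous_const continuous_re
    refine (hdiff.analyticOnNhd hopen).eqOn_of_preconnected_of_eventuallyEq
      ((ZMod.differentiable_LFunction_of_sum_zero hΦ).differentiableOn.analyticOnNhd hopen)
      (convex_halfSpace_re_gt 0).isPreconnected (z₀ := 2) (by simp) ?_
    have h2 : {z : ℂ | 1 < z.re} ∈ 𝓝 (2 : ℂ) :=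
      (isOpen_lt continuous_const continuous_re).mem_nhds (by simp)
    filter_upwards [h2] with z hz
    have hz : 1 < z.re := hz
    refine tendsto_nhds_unique (htend (by linarith)) ?_
    rw [ZMod.LFunction_eq_LSeries Φ hz]
    have := ((ZMod.LSeriesSummable_of_one_lt_re Φ hz).hasSum.tendsto_sum_nat).comp
      (tendsto_add_atTop_nat 1)
    refine this.congr fun M => ?_
    simp only [Function.comp, Finset.sum_range_succ', LSeries.term_zero, add_zero,
      sum_Icc_one_eq_sum_range]
    exact Finset.sum_congr rfl fun k _ => LSeries.term_of_ne_zero k.succ_ne_zero _ _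
  exact heq hs ▸ htend hs

end PeriodicDirichletSeries

namespace DirichletCharacter

open Complex

/-- The function `n ↦ (-1) ^ n * χ n` for a Dirichlet character `χ` modulo `N`, as a function on
residue classes modulo `2 * N`. -/
noncomputable def alternating {N : ℕ} (χ : DirichletCharacter ℂ N) (j : ZMod (2 * N)) : ℂ :=
  (-1) ^ j.val * χ (ZMod.castHom (dvd_mul_left N 2) (ZMod N) j)

theorem alternating_natCast {N : ℕ} (χ : DirichletCharacter ℂ N) (n : ℕ) :
    χ.alternating n = (-1) ^ n * χ n := by
  rw [alternating, map_natCast, ZMod.val_natCast]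
  congr 1
  conv_rhs => rw [← Nat.mod_add_div n (2 * N), pow_add, mul_assoc 2, pow_mul (-1 : ℂ) 2]
  simp

theorem sum_alternating_eq_zero {N : ℕ} [NeZero N] (hN : _root_.Odd N) (χ : DirichletCharacter ℂ N) :
    ∑ j, χ.alternating j = 0 := by
  have h : ∑ j, χ.alternating j = - ∑ j, χ.alternating j := by
    conv_lhs => rw [← Equiv.sum_comp (Equiv.addRight (N : ZMod (2 * N)))]
    rw [← Finset.sum_neg_distrib]
    refine Finset.sum_congr rfl fun j _ => ?_
    obtain ⟨n, rfl⟩ := ZMod.natCast_zmod_surjective j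
    simp only [Equiv.coe_addRight]
    rw [← Nat.cast_add, alternating_natCast, alternating_natCast, pow_add,
      hN.neg_one_pow]
    simp
  exact self_eq_neg.mp h

/-- For odd `N`, the Euler `L`-function of a Dirichlet character `χ` modulo `N` is twice the
`L`-function of `n ↦ (-1) ^ n * χ n`. -/
theorem isEulerLFunction_alternating {N : ℕ} [NeZero N] (hN : _root_.Odd N)
    (χ : DirichletCharacter ℂ N) :
    RefinedZeta.IsEulerLFunction χ fun s => 2 * ZMod.LFunction χ.alternating s where
  differentiable :=
    (ZMod.differentiable_LFunction_of_sum_zero (sum_alternating_eq_zero hN χ)).const_mul 2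
  tendsto s hs := by
    simpa only [alternating_natCast] using
      (tendsto_partialSums_of_sum_eq_zero (sum_alternating_eq_zero hN χ) hs).const_mul 2

theorem isEulerLFunction_eulerL {N : ℕ} [NeZero N] (hN : _root_.Odd N) (χ : DirichletCharacter ℂ N) :
    RefinedZeta.IsEulerLFunction χ (RefinedZeta.eulerL χ) := by
  have h : ∃ F, RefinedZeta.IsEulerLFunction χ F := ⟨_, isEulerLFunction_alternating hN χ⟩
  rw [RefinedZeta.eulerL, dif_pos h]
  exact h.choose_spec

theorem hasSum_neg_one_pow_mul {f : ℕ → ℂ} {a b : ℂ} (hf : HasSum f a)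
    (heven : HasSum (fun k => f (2 * k)) b) : HasSum (fun n => (-1) ^ n * f n) (2 * b - a) := by
  have hodd : Summable fun k => f (2 * k + 1) :=
    hf.summable.comp_injective (i := fun k : ℕ => 2 * k + 1) fun a b h => by simpa using h
  have hab := (heven.even_add_odd hodd.hasSum).unique hf
  rw [show 2 * b - a = b + -∑' k, f (2 * k + 1) by rw [← hab]; ring]
  refine HasSum.even_add_odd ?_ ?_
  · simpa using heven
  · simpa [pow_succ] using hodd.hasSum.neg

/-- `∑ (-1) ^ n χ(n) n ^ (-s) = -(1 - χ(2) 2 ^ (1 - s)) ∑ χ(n) n ^ (-s)`. -/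
theorem LSeries_alternating {N : ℕ} [NeZero N] (χ : DirichletCharacter ℂ N) {s : ℂ}
    (hs : 1 < s.re) :
    LSeries (fun n => (-1) ^ n * χ n) s = -(1 - χ 2 * 2 ^ (1 - s)) * LSeries (χ ·) s := by
  have hs0 : s ≠ 0 := ne_zero_of_one_lt_re hs
  have h1 : HasSum (LSeries.term (χ ·) s) (LSeries (χ ·) s) :=
    (ZMod.LSeriesSummable_of_one_lt_re χ hs).hasSum
  have heven (k : ℕ) : LSeries.term (χ ·) s (2 * k) = χ 2 * 2 ^ (-s) * LSeries.term (χ ·) s k := by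
    rw [LSeries.term_of_ne_zero' hs0, LSeries.term_of_ne_zero' hs0, Nat.cast_mul, Nat.cast_mul,
      map_mul, natCast_mul_natCast_cpow, cpow_neg]
    push_cast
    field_simp
  have h2 : HasSum (fun k => LSeries.term (χ ·) s (2 * k)) (χ 2 * 2 ^ (-s) * LSeries (χ ·) s) := by
    simpa only [heven] using h1.mul_left (χ 2 * 2 ^ (-s))
  have h3 := (hasSum_neg_one_pow_mul h1 h2).tsum_eq
  rw [sub_eq_add_neg 1 s, cpow_add _ _ two_ne_zero, cpow_one]
  calc LSeries (fun n => (-1) ^ n * χ n) s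
      = ∑' n, (-1) ^ n * LSeries.term (χ ·) s n := by
        refine tsum_congr fun n => ?_
        rw [LSeries.term_of_ne_zero' hs0, LSeries.term_of_ne_zero' hs0, mul_div_assoc]
    _ = _ := by rw [h3]; ring

theorem half_mul_eulerL {N : ℕ} [NeZero N] (hN : _root_.Odd N) (χ : DirichletCharacter ℂ N) {s : ℂ}
    (hs : 1 < s.re) :
    1 / 2 * RefinedZeta.eulerL χ s = -(1 - χ 2 * 2 ^ (1 - s)) * LSeries (χ ·) s := by
  have hs' : 0 < s.re := by linarith
  rw [tendsto_nhds_unique ((isEulerLFunction_eulerL hN χ).tendsto s hs')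
    ((isEulerLFunction_alternating hN χ).tendsto s hs'), ZMod.LFunction_eq_LSeries _ hs,
    ← LSeries_alternating χ hs]
  simp only [alternating_natCast]
  ring

end DirichletCharacter

section CharacterProduct

open Polynomial

theorem CommGroup.range_eval_eq_rootsOfUnity {G : Type*} [CommGroup G] [Finite G] (a : G) :
    (MonoidHom.eval a : (G →* ℂˣ) →* ℂˣ).range = rootsOfUnity (orderOf a) ℂ ∧
      Nat.card (MonoidHom.eval a : (G →* ℂˣ) →* ℂˣ).ker = Nat.card G / orderOf a := by
  set e : (G →* ℂˣ) →* ℂˣ := MonoidHom.eval a with he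
  have hpos : 0 < orderOf a := orderOf_pos a
  have : NeZero (orderOf a) := ⟨hpos.ne'⟩
  have hquot : Nat.card (G ⧸ Subgroup.zpowers a) * orderOf a = Nat.card G := by
    rw [← Nat.card_zpowers, ← Subgroup.card_eq_card_quotient_mul_card_subgroup]
  have hker : Nat.card e.ker * orderOf a = Nat.card G := by
    rw [← hquot, ← CommGroup.card_subgroupOrderIsoSubgroupMonoidHom (M := ℂ) (Subgroup.zpowers a)]
    congr 2
    suffices h : e.ker = (CommGroup.subgroupOrderIsoSubgroupMonoidHom G ℂ (Subgroup.zpowers a)).ofDual by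
      rw [h]
    refine Subgroup.ext fun ψ => ?_
    rw [CommGroup.mem_subgroupOrderIsoSubgroupMonoidHom_iff]
    simp [e, MonoidHom.mem_ker, Subgroup.mem_zpowers_iff]
    constructor
    · rintro h k
      simp [h]
    · intro h
      simpa using h 1
  refine ⟨Subgroup.eq_of_le_of_card_ge ?_ ?_, (Nat.div_eq_of_eq_mul_left hpos hker.symm).symm⟩
  · rintro _ ⟨ψ, rfl⟩
    rw [mem_rootsOfUnity]
    simp [e, ← map_pow, pow_orderOf_eq_one]
  · have h := e.ker.card_mul_index
    rw [Subgroup.index_ker, CommGroup.card_monoidHom_of_hasEnoughRootsOfUnity, ← hker] at h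
    rw [Complex.card_rootsOfUnity, Nat.eq_of_mul_eq_mul_left Nat.card_pos h]

/-- For `a` of order `f` in a finite commutative group `G`, the product of `1 - ψ(a) X` over the
complex characters `ψ` of `G` is `(1 - X ^ f) ^ (|G| / f)`. -/
theorem CommGroup.prod_one_sub_apply_mul {G : Type*} [CommGroup G] [Finite G]
    [Fintype (G →* ℂˣ)] (a : G) (X : ℂ) :
    ∏ ψ : G →* ℂˣ, (1 - (ψ a : ℂ) * X) = (1 - X ^ orderOf a) ^ (Nat.card G / orderOf a) := by
  classical
  obtain ⟨hrange, hker⟩ := CommGroup.range_eval_eq_rootsOfUnity a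
  set e : (G →* ℂˣ) →* ℂˣ := MonoidHom.eval a with he
  have hpos : 0 < orderOf a := orderOf_pos a
  have himage : Finset.univ.image (fun ψ : G →* ℂˣ => (ψ a : ℂ)) =
      nthRootsFinset (orderOf a) (1 : ℂ) := by
    ext z
    rw [mem_nthRootsFinset hpos]
    constructor
    · intro hz
      obtain ⟨ψ, -, rfl⟩ := Finset.mem_image.mp hz
      rw [← Units.val_pow_eq_pow_val, ← map_pow, pow_orderOf_eq_one]
      simp
    · intro hz
      have hz0 : IsUnit z := IsUnit.of_pow_eq_one hz hpos.ne'
      have : hz0.unit ∈ e.range := by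
        rw [hrange, mem_rootsOfUnity]
        ext
        simpa using hz
      obtain ⟨ψ, hψ⟩ := this
      exact Finset.mem_image.mpr ⟨ψ, Finset.mem_univ _, congrArg Units.val hψ⟩
  have hfiber (ψ₀ : G →* ℂˣ) :
      (Finset.univ.filter fun ψ : G →* ℂˣ => (ψ a : ℂ) = ψ₀ a).card =
        Nat.card G / orderOf a := by
    rw [← hker, Nat.card_eq_fintype_card, Fintype.card_subtype]
    have h := MonoidHom.card_fiber_eq_of_mem_range e (x := e ψ₀) (y := 1) ⟨ψ₀, rfl⟩ ⟨1, map_one e⟩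
    simp only [MonoidHom.mem_ker]
    rw [← h]
    simp only [he, MonoidHom.eval_apply_apply, Units.val_inj]
  rw [Finset.prod_comp (fun z : ℂ => 1 - z * X) (fun ψ : G →* ℂˣ => (ψ a : ℂ))]
  have hpow : ∀ z ∈ Finset.univ.image (fun ψ : G →* ℂˣ => (ψ a : ℂ)),
      (1 - z * X) ^ (Finset.univ.filter fun ψ : G →* ℂˣ => (ψ a : ℂ) = z).card =
        (1 - z * X) ^ (Nat.card G / orderOf a) := by
    intro z hz
    obtain ⟨ψ, -, rfl⟩ := Finset.mem_image.mp hz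
    rw [hfiber]
  rw [Finset.prod_congr rfl hpow, Finset.prod_pow, himage,
    ← (Complex.isPrimitiveRoot_exp _ hpos.ne').pow_sub_pow_eq_prod_sub_mul 1 X hpos, one_pow]

theorem DirichletCharacter.prod_one_sub_apply_mul {m : ℕ} [NeZero m] (a : (ZMod m)ˣ) (X : ℂ) :
    ∏ χ : DirichletCharacter ℂ m, (1 - χ a * X) =
      (1 - X ^ orderOf a) ^ (m.totient / orderOf a) := by
  have := Fintype.ofFinite ((ZMod m)ˣ →* ℂˣ)
  rw [← ZMod.card_units_eq_totient, ← Nat.card_eq_fintype_card,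
    ← CommGroup.prod_one_sub_apply_mul a X]
  exact Fintype.prod_equiv MulChar.equivToUnitHom _ _ fun χ => by simp

end CharacterProduct

namespace DirichletCharacter

theorem primitiveCharacter_natCast_of_coprime {m : ℕ} (χ : DirichletCharacter ℂ m) {q : ℕ}
    (hq : q.Coprime m) : χ.primitiveCharacter q = χ q := by
  simpa using χ.primitiveCharacter_apply_of_isCoprime (a := q) (Nat.isCoprime_iff_coprime.mpr hq)

theorem primitiveCharacter_natCast_prime {p k : ℕ} [Fact p.Prime]
    (χ : DirichletCharacter ℂ (p ^ k)) :
    χ.primitiveCharacter p = if χ = 1 then 1 else 0 := by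
  have : NeZero p := ⟨(Fact.out : p.Prime).ne_zero⟩
  split_ifs with h
  · have := eq_one_iff_conductor_eq_one.mp h
    have hs : Subsingleton (ZMod χ.conductor) := by
      rw [this]
      infer_instance
    rw [Subsingleton.elim ((p : ℕ) : ZMod χ.conductor) 1, map_one]
  · have h1 : χ.conductor ≠ 1 := fun h' => h (eq_one_iff_conductor_eq_one.mpr h')
    obtain ⟨j, -, hj⟩ := (Nat.dvd_prime_pow Fact.out).mp χ.conductor_dvd_level
    refine MulChar.map_nonunit _ fun hu => h1 ?_
    rw [ZMod.isUnit_iff_coprime, hj] at hu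
    rw [hj]
    rcases j with _ | j
    · simp
    · exact absurd ((Nat.coprime_pow_right_iff j.succ_pos _ _).mp hu)
        (by simpa using (Fact.out : p.Prime).ne_one)

end DirichletCharacter

namespace RefinedZeta

open Ideal

section ResiduePrime

variable {K : Type*} [Field K]

instance (v : HeightOneSpectrum (𝓞 K)) : NeZero v.asIdeal := ⟨v.ne_bot⟩

/-- The rational prime below a finite place. -/
noncomputable def residuePrime (v : HeightOneSpectrum (𝓞 K)) : Nat.Primes :=
  ⟨absNorm (under ℤ v.asIdeal), Nat.absNorm_under_prime v.asIdeal⟩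

theorem residuePrime_eq_iff_mem {v : HeightOneSpectrum (𝓞 K)} {q : Nat.Primes} :
    residuePrime v = q ↔ ((q : ℕ) : 𝓞 K) ∈ v.asIdeal := by
  have h : ((q : ℕ) : 𝓞 K) ∈ v.asIdeal ↔ (residuePrime v : ℕ) ∣ (q : ℕ) := by
    have := Int.cast_mem_ideal_iff (I := v.asIdeal) (d := (q : ℕ))
    rw [Int.cast_natCast, Int.natCast_dvd_natCast] at this
    exact this
  rw [h, Nat.prime_dvd_prime_iff_eq (residuePrime v).2 q.2]
  exact Subtype.ext_iff

theorem residuePrime_eq_iff_liesOver {v : HeightOneSpectrum (𝓞 K)} {q : Nat.Primes} :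
    residuePrime v = q ↔ v.asIdeal.LiesOver (span {((q : ℕ) : ℤ)}) := by
  constructor
  · rintro rfl
    exact Int.liesOver_span_absNorm v.asIdeal
  · intro h
    rw [residuePrime_eq_iff_mem]
    have : ((q : ℕ) : ℤ) ∈ under ℤ v.asIdeal := by
      rw [← h.over]
      exact mem_span_singleton_self _
    simpa [under_def, mem_comap] using this

end ResiduePrime

variable {K : Type*} [Field K] [NumberField K]

theorem image_asIdeal_residuePrime_fiber (q : Nat.Primes) :
    HeightOneSpectrum.asIdeal '' {v : HeightOneSpectrum (𝓞 K) | residuePrime v = q} =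
      primesOver (span {((q : ℕ) : ℤ)}) (𝓞 K) := by
  ext P
  constructor
  · rintro ⟨v, hv, rfl⟩
    exact ⟨v.isPrime, residuePrime_eq_iff_liesOver.mp hv⟩
  · rintro ⟨h1, h2⟩
    refine ⟨⟨P, h1, ?_⟩, residuePrime_eq_iff_liesOver.mpr h2, rfl⟩
    refine ne_bot_of_liesOver_of_ne_bot (p := span {((q : ℕ) : ℤ)}) ?_ P
    simpa using q.2.ne_zero

theorem finite_residuePrime_fiber (q : Nat.Primes) :
    {v : HeightOneSpectrum (𝓞 K) | residuePrime v = q}.Finite := by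
  refine Set.Finite.of_finite_image (f := HeightOneSpectrum.asIdeal) ?_
    (fun v _ w _ h => HeightOneSpectrum.ext h)
  rw [image_asIdeal_residuePrime_fiber]
  have : Fact (q : ℕ).Prime := ⟨q.2⟩
  have : (span {((q : ℕ) : ℤ)}).IsMaximal := Int.ideal_span_isMaximal_of_prime _
  exact IsDedekindDomain.primesOver_finite _ _

variable (K) in
/-- The finite places above a rational prime. -/
noncomputable def placesOver (q : Nat.Primes) : Finset (HeightOneSpectrum (𝓞 K)) :=
  (finite_residuePrime_fiber q).toFinset

@[simp]
theorem mem_placesOver {q : Nat.Primes} {v : HeightOneSpectrum (𝓞 K)} :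
    v ∈ placesOver K q ↔ residuePrime v = q := by
  simp [placesOver]

theorem card_placesOver (q : Nat.Primes) :
    (placesOver K q).card = (primesOver (span {((q : ℕ) : ℤ)}) (𝓞 K)).ncard := by
  rw [← image_asIdeal_residuePrime_fiber,
    Set.ncard_image_of_injective _ (fun v w h => HeightOneSpectrum.ext h), placesOver,
    Set.ncard_eq_toFinset_card _ (finite_residuePrime_fiber q)]

theorem card_placesOver_mul (q : Nat.Primes) [IsGalois ℚ K] :
    (placesOver K q).card * ((span {((q : ℕ) : ℤ)}).ramificationIdxIn (𝓞 K) *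
      (span {((q : ℕ) : ℤ)}).inertiaDegIn (𝓞 K)) = Nat.card Gal(K/ℚ) := by
  have : Fact (q : ℕ).Prime := ⟨q.2⟩
  have : (span {((q : ℕ) : ℤ)}).IsMaximal := Int.ideal_span_isMaximal_of_prime _
  rw [card_placesOver]
  exact ncard_primesOver_mul_ramificationIdxIn_mul_inertiaDegIn _ (𝓞 K) Gal(K/ℚ)

theorem card_placesOver_le (q : Nat.Primes) [IsGalois ℚ K] :
    (placesOver K q).card ≤ Nat.card Gal(K/ℚ) := by
  have h := card_placesOver_mul (K := K) q
  rw [← h]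
  refine Nat.le_mul_of_pos_right _ (Nat.pos_of_ne_zero fun h0 => ?_)
  rw [h0, mul_zero] at h
  exact Nat.card_pos.ne h

theorem placeNorm_eq_pow {v : HeightOneSpectrum (𝓞 K)} {q : Nat.Primes}
    (hv : residuePrime v = q) :
    absNorm v.asIdeal = (q : ℕ) ^ inertiaDeg v.asIdeal ℤ := by
  have := residuePrime_eq_iff_liesOver.mp hv
  simpa using (natAbs_pow_inertiaDeg ((q : ℕ) : ℤ) v.asIdeal).symm

open IsCyclotomicExtension.Rat

theorem prod_placesOver_of_coprime {m : ℕ} [NeZero m] [IsCyclotomicExtension {m} ℚ K]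
    {q : Nat.Primes} (hq : (q : ℕ).Coprime m) (X : ℂ) :
    ∏ v ∈ placesOver K q, (1 - X ^ inertiaDeg v.asIdeal ℤ) =
      ∏ χ : DirichletCharacter ℂ m, (1 - χ.primitiveCharacter (q : ℕ) * X) := by
  have : IsGalois ℚ K := IsCyclotomicExtension.isGalois {m} ℚ K
  have : Fact (q : ℕ).Prime := ⟨q.2⟩
  have hdvd : ¬ (q : ℕ) ∣ m := (Nat.Prime.coprime_iff_not_dvd q.2).mp hq
  have hord : orderOf (ZMod.unitOfCoprime (q : ℕ) hq) = orderOf (((q : ℕ) : ZMod m)) := by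
    rw [← orderOf_units, ZMod.coe_unitOfCoprime]
  have hinert : ∀ v ∈ placesOver K q, inertiaDeg v.asIdeal ℤ = orderOf (((q : ℕ) : ZMod m)) := by
    intro v hv
    have := residuePrime_eq_iff_liesOver.mp (mem_placesOver.mp hv)
    exact inertiaDeg_eq_of_not_dvd (q : ℕ) K v.asIdeal hdvd
  have hcard := card_placesOver_mul (K := K) q
  rw [ramificationIdxIn_eq_of_not_dvd (q : ℕ) K hdvd, inertiaDegIn_eq_of_not_dvd (q : ℕ) K hdvd,
    one_mul, Nat.card_congr (galEquivZMod m K).toEquiv, Nat.card_eq_fintype_card,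
    ZMod.card_units_eq_totient, ← hord] at hcard
  have hX := DirichletCharacter.prod_one_sub_apply_mul (ZMod.unitOfCoprime (q : ℕ) hq) X
  rw [← hcard, Nat.mul_div_cancel _ (orderOf_pos _), hord, ZMod.coe_unitOfCoprime] at hX
  rw [Finset.prod_congr rfl fun v hv => by rw [hinert v hv], Finset.prod_const, ← hX]
  exact Finset.prod_congr rfl fun χ _ => by
    rw [χ.primitiveCharacter_natCast_of_coprime hq]

theorem prod_placesOver_of_eq {p n : ℕ} [Fact p.Prime] [IsCyclotomicExtension {p ^ (n + 1)} ℚ K]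
    {q : Nat.Primes} (hq : (q : ℕ) = p) (X : ℂ) :
    ∏ v ∈ placesOver K q, (1 - X ^ inertiaDeg v.asIdeal ℤ) =
      ∏ χ : DirichletCharacter ℂ (p ^ (n + 1)), (1 - χ.primitiveCharacter (q : ℕ) * X) := by
  subst hq
  have hinert : ∀ v ∈ placesOver K q, inertiaDeg v.asIdeal ℤ = 1 := by
    intro v hv
    have := residuePrime_eq_iff_liesOver.mp (mem_placesOver.mp hv)
    exact inertiaDeg_eq_of_prime_pow (q : ℕ) n K v.asIdeal
  rw [Finset.prod_congr rfl fun v hv => by rw [hinert v hv], Finset.prod_const, card_placesOver,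
    ncard_primesOver_of_prime_pow (q : ℕ) n K, Finset.prod_eq_single 1]
  · rw [DirichletCharacter.primitiveCharacter_natCast_prime]
    simp
  · intro χ _ hχ
    rw [DirichletCharacter.primitiveCharacter_natCast_prime, if_neg hχ]
    simp
  · simp

/-- The Euler factors at a rational prime `q` of the Dedekind zeta function of the
`p ^ (n + 1)`-th cyclotomic field and of the `L`-functions of the primitive characters. -/
theorem prod_placesOver (p n : ℕ) [Fact p.Prime] [IsCyclotomicExtension {p ^ (n + 1)} ℚ K]
    (q : Nat.Primes) (X : ℂ) :
    ∏ v ∈ placesOver K q, (1 - X ^ inertiaDeg v.asIdeal ℤ) =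
      ∏ χ : DirichletCharacter ℂ (p ^ (n + 1)), (1 - χ.primitiveCharacter (q : ℕ) * X) := by
  by_cases hq : (q : ℕ) = p
  · exact prod_placesOver_of_eq hq X
  · exact prod_placesOver_of_coprime
      (Nat.Coprime.pow_right _ ((Nat.coprime_primes q.2 Fact.out).mpr hq)) X

end RefinedZeta

namespace RefinedZeta

open Ideal Filter Topology

variable {K : Type*} [Field K] [NumberField K]

theorem coe_placesOver (q : Nat.Primes) :
    (placesOver K q : Set (HeightOneSpectrum (𝓞 K))) = residuePrime ⁻¹' {q} := by
  ext v
  simp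

@[to_additive]
theorem hasProd_residuePrime_fiber {M : Type*} [CommMonoid M] [TopologicalSpace M]
    (f : HeightOneSpectrum (𝓞 K) → M) (q : Nat.Primes) :
    HasProd (fun v : {v : HeightOneSpectrum (𝓞 K) // residuePrime v = q} => f v)
      (∏ v ∈ placesOver K q, f v) := by
  have h := (placesOver K q).hasProd f
  rw [coe_placesOver] at h
  exact h

theorem placeNorm_cpow {v : HeightOneSpectrum (𝓞 K)} {q : Nat.Primes} (hv : residuePrime v = q)
    (z : ℂ) : placeNorm v ^ z = (((q : ℕ) : ℂ) ^ z) ^ inertiaDeg v.asIdeal ℤ := by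
  rw [placeNorm, placeNorm_eq_pow hv, Nat.cast_pow, ← Complex.natCast_cpow_natCast_mul,
    Complex.cpow_nat_mul]

theorem inertiaDeg_ne_zero (v : HeightOneSpectrum (𝓞 K)) : inertiaDeg v.asIdeal ℤ ≠ 0 :=
  (inertiaDeg_pos v.asIdeal ℤ).ne'

theorem norm_prime_cpow_le {z : ℂ} (hz : z.re ≤ 0) (q : Nat.Primes) :
    ‖((q : ℕ) : ℂ) ^ z‖ ≤ 1 := by
  rw [Complex.norm_natCast_cpow_of_pos q.2.pos]
  exact Real.rpow_le_one_of_one_le_of_nonpos (by exact_mod_cast q.2.one_lt.le) hz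

theorem norm_placeNorm_cpow_le {v : HeightOneSpectrum (𝓞 K)} {q : Nat.Primes}
    (hv : residuePrime v = q) {z : ℂ} (hz : z.re ≤ 0) :
    ‖placeNorm v ^ z‖ ≤ ((q : ℕ) : ℝ) ^ z.re := by
  rw [placeNorm_cpow hv, norm_pow, ← Complex.norm_natCast_cpow_of_pos q.2.pos]
  exact pow_le_of_le_one (norm_nonneg _) (norm_prime_cpow_le hz q) (inertiaDeg_ne_zero v)

theorem norm_placeNorm_cpow_lt_one (v : HeightOneSpectrum (𝓞 K)) {z : ℂ} (hz : z.re < 0) :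
    ‖placeNorm v ^ z‖ < 1 :=
  (norm_placeNorm_cpow_le rfl hz.le).trans_lt
    (Real.rpow_lt_one_of_one_lt_of_neg (by exact_mod_cast (residuePrime v).2.one_lt) hz)

theorem one_sub_placeNorm_cpow_ne_zero (v : HeightOneSpectrum (𝓞 K)) {z : ℂ} (hz : z.re < 0) :
    1 - placeNorm v ^ z ≠ 0 := by
  intro h
  have := norm_placeNorm_cpow_lt_one v hz
  rw [← sub_eq_zero.mp h, norm_one] at this
  exact lt_irrefl _ this

theorem summable_norm_placeNorm_cpow [IsGalois ℚ K] {s : ℂ} (hs : 1 < s.re) :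
    Summable fun v : HeightOneSpectrum (𝓞 K) => ‖placeNorm v ^ (-s)‖ := by
  rw [← (Equiv.sigmaFiberEquiv (residuePrime (K := K))).summable_iff,
    summable_sigma_of_nonneg (fun _ => by simp)]
  have hfin (q : Nat.Primes) : Finite {v : HeightOneSpectrum (𝓞 K) // residuePrime v = q} :=
    finite_residuePrime_fiber q
  refine ⟨fun q => Summable.of_finite, ?_⟩
  have hq : Summable fun q : Nat.Primes => (Nat.card Gal(K/ℚ) : ℝ) * ((q : ℕ) : ℝ) ^ (-s).re :=
    (Nat.Primes.summable_rpow.mpr (by rw [Complex.neg_re]; linarith)).mul_left _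
  refine hq.of_nonneg_of_le (fun q => tsum_nonneg fun _ => norm_nonneg _) fun q => ?_
  refine (hasSum_residuePrime_fiber (fun v : HeightOneSpectrum (𝓞 K) => ‖placeNorm v ^ (-s)‖)
    q).tsum_eq.trans_le ?_
  calc ∑ v ∈ placesOver K q, ‖placeNorm v ^ (-s)‖
      ≤ (placesOver K q).card • ((q : ℕ) : ℝ) ^ (-s).re :=
        Finset.sum_le_card_nsmul _ _ _ fun v hv =>
          norm_placeNorm_cpow_le (mem_placesOver.mp hv) (by rw [Complex.neg_re]; linarith)
    _ ≤ _ := by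
        rw [nsmul_eq_mul]
        gcongr
        exact card_placesOver_le q

theorem multipliable_localFactor [IsGalois ℚ K] {s : ℂ} (hs : 1 < s.re) :
    Multipliable fun v : HeightOneSpectrum (𝓞 K) => localFactor s v := by
  have hsum := summable_norm_placeNorm_cpow (K := K) hs
  have hne (v : HeightOneSpectrum (𝓞 K)) : 1 - placeNorm v ^ (-s) ≠ 0 :=
    one_sub_placeNorm_cpow_ne_zero v (by rw [Complex.neg_re]; linarith)
  have h1 (v : HeightOneSpectrum (𝓞 K)) : localFactor s v =
      1 + placeNorm v ^ (-s) * (1 - placeNorm v ^ (-s))⁻¹ := by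
    rw [localFactor]
    field_simp [hne v]
    ring
  simp only [h1]
  refine multipliable_one_add_of_summable ?_
  refine Summable.of_norm_bounded_eventually (g := fun v => 2 * ‖placeNorm v ^ (-s)‖)
    (hsum.mul_left 2) ?_
  have hev : ∀ᶠ v : HeightOneSpectrum (𝓞 K) in cofinite, ‖placeNorm v ^ (-s)‖ < 1 / 2 :=
    hsum.tendsto_cofinite_zero.eventually (gt_mem_nhds (by norm_num))
  filter_upwards [hev] with v hv
  have h2 : 1 / 2 ≤ ‖1 - placeNorm v ^ (-s)‖ := by
    have := norm_sub_norm_le 1 (placeNorm v ^ (-s))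
    rw [norm_one] at this
    linarith
  rw [norm_norm, norm_mul, norm_inv, mul_comm 2]
  gcongr
  exact inv_le_of_inv_le₀ (by norm_num) (by linarith)

/-- Every finite place is outside the set of infinite places. -/
def finitePlaceEquiv (K : Type*) [Field K] [NumberField K] :
    {v : HeightOneSpectrum (𝓞 K) // Sum.inr v ∉ infinitePlaces K} ≃ HeightOneSpectrum (𝓞 K) :=
  Equiv.subtypeUnivEquiv fun v => by simp [infinitePlaces]

theorem multipliable_localFactor_infinitePlaces [IsGalois ℚ K] {s : ℂ} (hs : 1 < s.re) :
    Multipliable (fun v : {v : HeightOneSpectrum (𝓞 K) // Sum.inr v ∉ infinitePlaces K} =>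
      localFactor s v.1) :=
  (finitePlaceEquiv K).multipliable_iff.mpr (multipliable_localFactor hs)

theorem eulerProduct_infinitePlaces (s : ℂ) :
    eulerProduct (infinitePlaces K) s = ∏' v : HeightOneSpectrum (𝓞 K), localFactor s v :=
  (finitePlaceEquiv K).tprod_eq (localFactor s)

/-- On `1 < re s`, the Euler product of the `p ^ (n + 1)`-th cyclotomic field is the product of
the Dirichlet `L`-series of the primitive characters of conductor dividing `p ^ (n + 1)`. -/
theorem eulerProduct_eq_prod_LSeries (p n : ℕ) [Fact p.Prime]
    [IsCyclotomicExtension {p ^ (n + 1)} ℚ K] {s : ℂ} (hs : 1 < s.re) :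
    eulerProduct (infinitePlaces K) s = ∏ χ : DirichletCharacter ℂ (p ^ (n + 1)),
      LSeries (fun k => χ.primitiveCharacter k) s := by
  have : IsGalois ℚ K := IsCyclotomicExtension.isGalois {p ^ (n + 1)} ℚ K
  have h1 : HasProd (fun q => ∏ v ∈ placesOver K q, localFactor s v)
      (∏' v : HeightOneSpectrum (𝓞 K), localFactor s v) := by
    have h := (multipliable_localFactor (K := K) hs).hasProd
    exact ((Equiv.sigmaFiberEquiv residuePrime).hasProd_iff.mpr h).sigma fun q =>
      hasProd_residuePrime_fiber (localFactor s) q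
  have hχ (χ : DirichletCharacter ℂ (p ^ (n + 1))) : HasProd (fun q : Nat.Primes =>
      (1 - χ.primitiveCharacter (q : ℕ) * ((q : ℕ) : ℂ) ^ (-s))⁻¹)
      (LSeries (fun k => χ.primitiveCharacter k) s) :=
    χ.primitiveCharacter.LSeries_eulerProduct_hasProd hs
  have h2 : HasProd (fun q : Nat.Primes => ∏ χ : DirichletCharacter ℂ (p ^ (n + 1)),
      (1 - χ.primitiveCharacter (q : ℕ) * ((q : ℕ) : ℂ) ^ (-s))⁻¹)
      (∏ χ : DirichletCharacter ℂ (p ^ (n + 1)), LSeries (fun k => χ.primitiveCharacter k) s) :=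
    hasProd_prod fun χ _ => hχ χ
  rw [eulerProduct_infinitePlaces]
  refine h1.unique (h2.congr_fun fun q => ?_)
  rw [Finset.prod_inv_distrib, ← prod_placesOver (K := K) p n, ← Finset.prod_inv_distrib]
  exact Finset.prod_congr rfl fun v hv => by
    rw [localFactor, placeNorm_cpow (mem_placesOver.mp hv)]

theorem placesAboveTwo_eq_placesOver {q : Nat.Primes} (hq : (q : ℕ) = 2) :
    placesAboveTwo K = placesOver K q := by
  ext v
  rw [mem_placesOver, residuePrime_eq_iff_mem, hq]
  simp [placesAboveTwo]

theorem prod_placesAboveTwo (p n : ℕ) [Fact p.Prime] [IsCyclotomicExtension {p ^ (n + 1)} ℚ K]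
    (s : ℂ) :
    ∏ v ∈ placesAboveTwo K, (1 - placeNorm v ^ (1 - s)) =
      ∏ χ : DirichletCharacter ℂ (p ^ (n + 1)),
        (1 - χ.primitiveCharacter 2 * (2 : ℂ) ^ (1 - s)) := by
  obtain ⟨q, hq⟩ : ∃ q : Nat.Primes, (q : ℕ) = 2 := ⟨⟨2, Nat.prime_two⟩, rfl⟩
  have h := prod_placesOver (K := K) p n q ((2 : ℂ) ^ (1 - s))
  simp only [hq, Nat.cast_ofNat] at h
  rw [placesAboveTwo_eq_placesOver hq, ← h]
  refine Finset.prod_congr rfl fun v hv => ?_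
  rw [placeNorm_cpow (mem_placesOver.mp hv), hq, Nat.cast_ofNat]

theorem odd_conductor {p n : ℕ} [Fact p.Prime] (hp : p ≠ 2) (χ : DirichletCharacter ℂ (p ^ n)) :
    Odd χ.conductor :=
  Odd.of_dvd_nat ((Nat.Prime.odd_of_ne_two Fact.out hp).pow) χ.conductor_dvd_level

instance {N : ℕ} [NeZero N] (χ : DirichletCharacter ℂ N) : NeZero χ.conductor :=
  ⟨χ.conductor_ne_zero⟩

theorem even_card_dirichletCharacter {p : ℕ} (n : ℕ) [Fact p.Prime] (hp : p ≠ 2) :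
    Even (Fintype.card (DirichletCharacter ℂ (p ^ (n + 1)))) := by
  have hp2 : 2 < p := lt_of_le_of_ne (Fact.out : p.Prime).two_le hp.symm
  rw [← Nat.card_eq_fintype_card, DirichletCharacter.card_eq_totient_of_hasEnoughRootsOfUnity]
  exact Nat.totient_even (hp2.trans_le (Nat.le_self_pow n.succ_ne_zero p))

/-- The decomposition of the refined zeta function on `1 < re s`. -/
theorem prod_placesAboveTwo_mul_eulerProduct (p n : ℕ) [Fact p.Prime] (hp : p ≠ 2)
    [IsCyclotomicExtension {p ^ (n + 1)} ℚ K] {s : ℂ} (hs : 1 < s.re) :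
    (∏ v ∈ placesAboveTwo K, (1 - placeNorm v ^ (1 - s))) * eulerProduct (infinitePlaces K) s =
      ∏ χ : DirichletCharacter ℂ (p ^ (n + 1)), 1 / 2 * eulerL χ.primitiveCharacter s := by
  rw [Fintype.prod_congr _ _ fun χ => χ.primitiveCharacter.half_mul_eulerL
    (odd_conductor hp χ) hs, Finset.prod_mul_distrib, Finset.prod_neg, Finset.card_univ,
    (even_card_dirichletCharacter n hp).neg_one_pow, one_mul, prod_placesAboveTwo p n,
    eulerProduct_eq_prod_LSeries p n hs]

theorem toDirichlet_bijective (m : ℕ) [NeZero m] (K : Type*) [Field K] [NumberField K]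
    [IsCyclotomicExtension {m} ℚ K] : Function.Bijective (toDirichlet m K) := by
  let e := IsCyclotomicExtension.Rat.galEquivZMod m K
  refine (MulChar.equivToUnitHom (R := ZMod m) (R' := ℂ)).symm.bijective.comp
    (f := fun ψ : Gal(K/ℚ) →* ℂˣ => ψ.comp e.symm.toMonoidHom) ⟨fun ψ φ h => ?_, fun ψ => ?_⟩
  · ext σ
    have := DFunLike.congr_fun h (e σ)
    simpa using congrArg Units.val this
  · refine ⟨ψ.comp e.toMonoidHom, ?_⟩
    ext a
    simp

theorem finprod_inducedPrimitive (m : ℕ) [NeZero m] (K : Type*) [Field K] [NumberField K]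
    [IsCyclotomicExtension {m} ℚ K] (s : ℂ) :
    ∏ᶠ ψ : Gal(K/ℚ) →* ℂˣ, 1 / 2 * eulerL (inducedPrimitive m K ψ) s =
      ∏ χ : DirichletCharacter ℂ m, 1 / 2 * eulerL χ.primitiveCharacter s := by
  rw [← finprod_eq_prod_of_fintype]
  exact finprod_eq_of_bijective _ (toDirichlet_bijective m K) fun ψ => rfl

section Meromorphic

theorem toMeromorphicNFOn_univ_apply_of_eventuallyEq {f g : ℂ → ℂ}
    (hf : MeromorphicOn f Set.univ) {x : ℂ} (hg : MeromorphicNFAt g x) (h : f =ᶠ[𝓝[≠] x] g) :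
    toMeromorphicNFOn f Set.univ x = g x := by
  rw [toMeromorphicNFOn_eq_toMeromorphicNFAt hf (Set.mem_univ x),
    (toMeromorphicNFAt_eventuallyEq_nhds_congr h).eq_of_nhds, toMeromorphicNFAt_eq_self.mpr hg]

/-- **Identity theorem** for meromorphic functions on the plane. -/
theorem eventuallyEq_nhdsNE_of_meromorphicOn_univ {f g : ℂ → ℂ} (hf : MeromorphicOn f Set.univ)
    (hg : MeromorphicOn g Set.univ) {x₀ : ℂ} (h : f =ᶠ[𝓝[≠] x₀] g) (x : ℂ) :
    f =ᶠ[𝓝[≠] x] g := by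
  have hd : MeromorphicOn (f - g) Set.univ := hf.sub hg
  have key : meromorphicOrderAt (f - g) x = ⊤ := by
    by_contra hx
    refine hd.meromorphicOrderAt_ne_top_of_isPreconnected isPreconnected_univ (Set.mem_univ x)
      (Set.mem_univ x₀) hx ?_
    rw [meromorphicOrderAt_eq_top_iff]
    filter_upwards [h] with z hz
    simp [hz]
  filter_upwards [meromorphicOrderAt_eq_top_iff.mp key] with z hz
  exact sub_eq_zero.mp hz

end Meromorphic

theorem differentiable_prod_placesAboveTwo :
    Differentiable ℂ fun s : ℂ => ∏ v ∈ placesAboveTwo K, (1 - placeNorm v ^ (1 - s)) := by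
  refine Differentiable.fun_finsetProd fun v _ s => ?_
  have hv : placeNorm v ≠ 0 := by
    rw [placeNorm, Nat.cast_ne_zero, ne_eq, absNorm_eq_zero_iff]
    exact v.ne_bot
  exact (((differentiableAt_id.const_sub 1).const_cpow (.inl hv)).const_sub 1)

theorem differentiable_prod_eulerL {p n : ℕ} [Fact p.Prime] (hp : p ≠ 2) :
    Differentiable ℂ fun s => ∏ χ : DirichletCharacter ℂ (p ^ n),
      1 / 2 * eulerL χ.primitiveCharacter s :=
  Differentiable.fun_finsetProd fun χ _ =>
    (χ.primitiveCharacter.isEulerLFunction_eulerL (odd_conductor hp χ)).differentiable.const_mul _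

theorem isMeromorphicContinuation_zetaS (p n : ℕ) [Fact p.Prime] (hp : p ≠ 2)
    [IsCyclotomicExtension {p ^ (n + 1)} ℚ K] :
    IsMeromorphicContinuation (eulerProduct (infinitePlaces K)) {s : ℂ | 1 < s.re}
      (zetaS (infinitePlaces K)) := by
  suffices h : ∃ F, IsMeromorphicContinuation (eulerProduct (infinitePlaces K))
      {s : ℂ | 1 < s.re} F by
    rw [zetaS, meromorphicContinuation, dif_pos h]
    exact h.choose_spec
  set T : ℂ → ℂ := fun s => ∏ v ∈ placesAboveTwo K, (1 - placeNorm v ^ (1 - s)) with hT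
  set L : ℂ → ℂ := fun s => ∏ χ : DirichletCharacter ℂ (p ^ (n + 1)),
      1 / 2 * eulerL χ.primitiveCharacter s with hL
  have hTd : Differentiable ℂ T := differentiable_prod_placesAboveTwo
  have hLd : Differentiable ℂ L := differentiable_prod_eulerL hp
  have hmer : MeromorphicOn (L / T) Set.univ := fun x _ =>
    (hLd.analyticAt x).meromorphicAt.div (hTd.analyticAt x).meromorphicAt
  refine ⟨toMeromorphicNFOn (L / T) Set.univ, meromorphicNFOn_toMeromorphicNFOn _ _, fun s hs => ?_⟩
  have hs : 1 < s.re := hs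
  have hTs : T s ≠ 0 := Finset.prod_ne_zero_iff.mpr fun v _ =>
    one_sub_placeNorm_cpow_ne_zero v (by simpa using hs)
  rw [toMeromorphicNFOn_univ_apply_of_eventuallyEq hmer
    ((hLd.analyticAt s).div (hTd.analyticAt s) hTs).meromorphicNFAt EventuallyEq.rfl,
    Pi.div_apply, div_eq_iff hTs, mul_comm]
  exact (prod_placesAboveTwo_mul_eulerProduct p n hp hs).symm

theorem refinedZeta_eq_prod_eulerL (p n : ℕ) [Fact p.Prime] (hp : p ≠ 2)
    [IsCyclotomicExtension {p ^ (n + 1)} ℚ K] (s : ℂ) :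
    refinedZeta (infinitePlaces K) (placesAboveTwo K) s =
      ∏ χ : DirichletCharacter ℂ (p ^ (n + 1)), 1 / 2 * eulerL χ.primitiveCharacter s := by
  have hcont := isMeromorphicContinuation_zetaS (K := K) p n hp
  have hL : Differentiable ℂ fun s => ∏ χ : DirichletCharacter ℂ (p ^ (n + 1)),
    1 / 2 * eulerL χ.primitiveCharacter s := differentiable_prod_eulerL hp
  have hmer : MeromorphicOn (fun s => (∏ v ∈ placesAboveTwo K, (1 - placeNorm v ^ (1 - s))) *
      zetaS (infinitePlaces K) s) Set.univ := fun x hx =>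
    (differentiable_prod_placesAboveTwo.analyticAt x).meromorphicAt.mul
      (hcont.meromorphicNFOn.meromorphicOn x hx)
  refine toMeromorphicNFOn_univ_apply_of_eventuallyEq hmer (hL.analyticAt s).meromorphicNFAt
    (eventuallyEq_nhdsNE_of_meromorphicOn_univ hmer
      (fun x _ => (hL.analyticAt x).meromorphicAt) (x₀ := 2) ?_ s)
  have h2 : {z : ℂ | 1 < z.re} ∈ 𝓝 (2 : ℂ) :=
    (isOpen_lt continuous_const Complex.continuous_re).mem_nhds (by simp)
  filter_upwards [mem_nhdsWithin_of_mem_nhds h2] with z hz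
  rw [hcont.eqOn hz]
  exact prod_placesAboveTwo_mul_eulerProduct p n hp hz

end RefinedZeta

theorem proposition3p1 (p n : ℕ) [Fact p.Prime] (hp : p ≠ 2)
    (K : Type*) [Field K] [NumberField K] [IsCyclotomicExtension {p ^ (n + 1)} ℚ K] :
    -- the Euler product converges for `1 < re s` and has a meromorphic continuation
    (∀ s : ℂ, 1 < s.re → Multipliable
      (fun v : {v : HeightOneSpectrum (𝓞 K) // Sum.inr v ∉ RefinedZeta.infinitePlaces K} =>
        RefinedZeta.localFactor s v.1)) ∧
    RefinedZeta.IsMeromorphicContinuation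
      (RefinedZeta.eulerProduct (RefinedZeta.infinitePlaces K)) {s : ℂ | 1 < s.re}
      (RefinedZeta.zetaS (RefinedZeta.infinitePlaces K)) ∧
    -- the Euler series converge for `0 < re s` and extend to entire functions
    (∀ ψ : Gal(K/ℚ) →* ℂˣ, RefinedZeta.IsEulerLFunction
      (RefinedZeta.inducedPrimitive (p ^ (n + 1)) K ψ)
      (RefinedZeta.eulerL (RefinedZeta.inducedPrimitive (p ^ (n + 1)) K ψ))) ∧
    -- the decomposition holds on the whole plane (the product has finitely many factors)
    ∀ s : ℂ,
      RefinedZeta.refinedZeta (RefinedZeta.infinitePlaces K) (RefinedZeta.placesAboveTwo K) s =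
        ∏ᶠ ψ : Gal(K/ℚ) →* ℂˣ,
          (1 / 2) * RefinedZeta.eulerL (RefinedZeta.inducedPrimitive (p ^ (n + 1)) K ψ) s := by
  have : IsGalois ℚ K := IsCyclotomicExtension.isGalois {p ^ (n + 1)} ℚ K
  refine ⟨fun s hs => RefinedZeta.multipliable_localFactor_infinitePlaces hs,
    RefinedZeta.isMeromorphicContinuation_zetaS p n hp, fun ψ => ?_, fun s => ?_⟩
  · exact DirichletCharacter.isEulerLFunction_eulerL (RefinedZeta.odd_conductor hp _) _
  · rw [RefinedZeta.refinedZeta_eq_prod_eulerL p n hp s, RefinedZeta.finprod_inducedPrimitive]
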